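/- Let $\mathcal G=(V,E,\mathcal B)$ be a locally finite Borel graph; that is, $(V,\mathcal B)$ is a standard Borel space, $E\subseteq V\times V$ is a Borel, symmetric and anti-reflexive relation, and every vertex has finitely many neighbours. Suppose that $\mathcal G$ admits a Borel transversal $X\subseteq V$, i.e. a Borel set containing exactly one vertex from every connectivity component of $\mathcal G$. Let $\ell:V\to\omega$ be a Borel function, where $\omega=\{0,1,2,\dots\}$, and let $n\in\omega$ be identified with the set $\{0,\dots,n-1\}$. Let $\mathcal C$ be a locally checkable labelling problem (LCL), that is, a $\{0,1\}$-valued local rule on graphs with $\omega^2$-valued vertex labellings: for some radius $r\in\omega$, the value of $\mathcal C$ at a vertex $x$ depends only on the isomorphism type (where isomorphisms preserve labels and the root) of the labelled graph induced by the ball of all vertices at distance at most $r$ from $x$, rooted at $x$. A function $a:V\to\omega$ is said to solve $\mathcal C$ on $(\mathcal G,\ell)$ if $\mathcal C$ takes the value $1$ at every vertex of $\mathcal G$ when the vertices $y\in V$ are labelled by $(\ell(y),a(y))$. If there is a (not necessarily Borel) function $V\to n$ that solves $\mathcal C$ on $(\mathcal G,\ell)$, then there is a Borel function $V\to n$ that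 solves $\mathcal C$ on $(\mathcal G,\ell)$. -/

import Mathlib

namespace BorelLCL

universe u

/-- A Borel graph: the edge set, viewed as a symmetric subset of `V × V`, is Borel.
The vertex set carries a standard Borel structure (required where this is used). -/
def IsBorelGraph {V : Type u} [MeasurableSpace V] (G : SimpleGraph V) : Prop :=
  MeasurableSet {p : V × V | G.Adj p.1 p.2}

/-- Every vertex has finitely many neighbours. -/
def IsLocallyFinite {V : Type u} (G : SimpleGraph V) : Prop :=
  ∀ x : V, (G.neighborSet x).Finite

/-- `X` contains exactly one vertex from every connectivity component of `G`. -/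
def IsTransversal {V : Type u} (G : SimpleGraph V) (X : Set V) : Prop :=
  ∀ K : G.ConnectedComponent, ∃! x : V, x ∈ X ∧ x ∈ K.supp

/-- The set of vertices at distance at most `r` from `x`. The distance is the extended one, so
vertices in other components are at infinite distance and are not included. -/
def closedBall {V : Type u} (G : SimpleGraph V) (x : V) (r : ℕ) : Set V :=
  {y : V | G.edist x y ≤ (r : ℕ∞)}

theorem self_mem_closedBall {V : Type u} (G : SimpleGraph V) (x : V) (r : ℕ) :
    x ∈ closedBall G x r := by
  simp [closedBall]

/-- A rooted graph whose vertices are labelled by elements of `L`. -/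
structure RootedLabelledGraph (L : Type) where
  /-- the vertex set -/
  carrier : Type u
  /-- the underlying graph -/
  graph : SimpleGraph carrier
  /-- the vertex labelling -/
  label : carrier → L
  /-- the root -/
  root : carrier

/-- Isomorphism of rooted labelled graphs: a graph isomorphism that preserves the labels and
the root. -/
def RootedLabelledGraph.Isomorphic {L : Type} (A B : RootedLabelledGraph.{u} L) : Prop :=
  ∃ φ : A.graph ≃g B.graph, (∀ v, B.label (φ v) = A.label v) ∧ φ A.root = B.root

instance RootedLabelledGraph.setoid (L : Type) : Setoid (RootedLabelledGraph.{u} L) where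
  r := RootedLabelledGraph.Isomorphic
  iseqv :=
    { refl := fun _ => ⟨SimpleGraph.Iso.refl, fun _ => rfl, rfl⟩
      symm := by
        rintro A B ⟨φ, hl, hr⟩
        refine ⟨φ.symm, fun v => ?_, ?_⟩
        · rw [← hl, RelIso.apply_symm_apply]
        · rw [← hr, RelIso.symm_apply_apply]
      trans := by
        rintro A B C ⟨φ, hl, hr⟩ ⟨ψ, hl', hr'⟩
        refine ⟨φ.trans ψ, fun v => ?_, ?_⟩
        · rw [RelIso.trans_apply, hl', hl]
        · rw [RelIso.trans_apply, hr, hr'] }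

/-- Isomorphism types of rooted labelled graphs. -/
def IsoType (L : Type) : Type (u + 1) :=
  Quotient (RootedLabelledGraph.setoid.{u} L)

/-- The labelled graph that the `r`-ball around `x` induces in `(G, lab)`, rooted at `x`. -/
def rootedBall {V : Type u} {L : Type} (G : SimpleGraph V) (lab : V → L) (r : ℕ) (x : V) :
    RootedLabelledGraph.{u} L where
  carrier := closedBall G x r
  graph := G.induce (closedBall G x r)
  label := fun y => lab y
  root := ⟨x, self_mem_closedBall G x r⟩

/-- The isomorphism type of the rooted labelled `r`-ball around `x`. -/
def ballType {V : Type u} {L : Type} (G : SimpleGraph V) (lab : V → L) (r : ℕ) (x : V) :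
    IsoType.{u} L :=
  Quotient.mk _ (rootedBall G lab r x)

/-- A locally checkable labelling problem: a `{0,1}`-valued local rule, of some radius, whose
inputs are graphs with `ω²`-valued labellings. The value at a vertex is a function of the
isomorphism type of the rooted labelled ball around it. -/
structure LCL where
  /-- the radius of the local rule -/
  radius : ℕ
  /-- the value of the rule on each isomorphism type -/
  rule : IsoType.{u} (ℕ × ℕ) → Bool

/-- The value at `x` of the local rule on the graph `G` with the `ω²`-valued labelling `lab`. -/
def LCL.value (C : LCL.{u}) {V : Type u} (G : SimpleGraph V) (lab : V → ℕ × ℕ) (x : V) : Bool :=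
  C.rule (ballType G lab C.radius x)

/-- The assignment `a` solves the problem `C` on the labelled graph `(G, ℓ)`: the rule returns
the value `1` at every vertex of the labelled graph `(G, (ℓ, a))`. -/
def LCL.Solves (C : LCL.{u}) {V : Type u} (G : SimpleGraph V) (ℓ a : V → ℕ) : Prop :=
  ∀ x : V, C.value G (fun y => (ℓ y, a y)) x = true

end BorelLCL

/-! Enumerate each component from its transversal point. Labellings of that component become
sequences in the compact space of maps from `ℕ` to `Fin n`, and each vertex imposes a constraint on
finitely many entries. A solution is then built one entry at a time, always keeping every finite set
of constraints satisfiable by a finite extension. This test quantifies over countable sets only, so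
the choices are Borel functions of the transversal point (`exists_measurable_solution`).

Two facts make the setting Borel. Components have Borel enumerations: a Borel relation with finite
sections is covered by countably many Borel functions (`exists_measurable_enumeration`), which
follows from Novikov's separation theorem for analytic sets. Moreover, the verdict of the local rule
is Borel in the vertex, because a finite labelled ball is coded by an element of a countable set
(`measurable_ballType`). -/

namespace BorelLCL
open Set Function MeasureTheory

/-! ### Novikov separation of analytic sets -/

/-- A property of finite prefixes that survives one more entry holds along an infinite branch. -/
theorem exists_branch {P : ℕ → (ℕ → ℕ) → Prop}
    (hcongr : ∀ m α β, (∀ i < m, α i = β i) → P m α → P m β) (α₀ : ℕ → ℕ) (h₀ : P 0 α₀)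
    (hstep : ∀ m α, P m α → ∃ i, P (m + 1) (update α m i)) : ∃ α, ∀ m, P m α := by
  choose! next hnext using hstep
  let s : ℕ → ℕ → ℕ := fun m => Nat.rec α₀ (fun m α => update α m (next m α)) m
  have hs : ∀ m, s (m + 1) = update (s m) m (next m (s m)) := fun _ => rfl
  have hP : ∀ m, P m (s m) := by
    intro m
    induction m with
    | zero => exact h₀
    | succ m ih => rw [hs]; exact hnext _ _ ih
  have hstable : ∀ i d, s (i + 1 + d) i = s (i + 1) i := by
    intro i d
    induction d with
    | zero => rfl
    | succ d ih =>
      rw [← add_assoc, hs, update_of_ne (by omega), ih]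
  refine ⟨fun i => s (i + 1) i, fun m => hcongr m _ _ (fun i hi => ?_) (hP m)⟩
  obtain ⟨d, rfl⟩ : ∃ d, m = i + 1 + d := ⟨m - (i + 1), by omega⟩
  exact hstable i d

/-- A sequence of sets is enlarged by measurable sets with empty intersection. -/
def MeasurablySeparableSeq {Z : Type*} [MeasurableSpace Z] (A : ℕ → Set Z) : Prop :=
  ∃ B : ℕ → Set Z, (∀ k, A k ⊆ B k) ∧ (∀ k, MeasurableSet (B k)) ∧ ⋂ k, B k = ∅

theorem MeasurablySeparableSeq.mono {Z : Type*} [MeasurableSpace Z] {A A' : ℕ → Set Z}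
    (h : MeasurablySeparableSeq A') (hA : ∀ k, A k ⊆ A' k) : MeasurablySeparableSeq A := by
  obtain ⟨B, h₁, h₂, h₃⟩ := h
  exact ⟨B, fun k => (hA k).trans (h₁ k), h₂, h₃⟩

/-- Take the union of the enlargements at `k₀` and their intersection at every other index. A common
point lies in the `i`-th enlargement at `k₀` for some `i`, hence in all sets of the `i`-th family.
Contrapositively, non-separability survives splitting one set into countably many pieces. -/
theorem MeasurablySeparableSeq.of_iUnion {Z : Type*} [MeasurableSpace Z] {A : ℕ → Set Z} {k₀ : ℕ}
    {A' : ℕ → ℕ → Set Z} (h : ∀ i, MeasurablySeparableSeq (A' i))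
    (h₀ : A k₀ ⊆ ⋃ i, A' i k₀) (hne : ∀ i k, k ≠ k₀ → A k ⊆ A' i k) :
    MeasurablySeparableSeq A := by
  choose B hAB hB hB0 using h
  refine ⟨fun k => if k = k₀ then ⋃ i, B i k else ⋂ i, B i k, fun k => ?_, fun k => ?_, ?_⟩
  · dsimp only
    split_ifs with hk
    · subst hk
      exact h₀.trans (iUnion_mono fun i => hAB i k)
    · exact subset_iInter fun i => (hne i k hk).trans (hAB i k)
  · dsimp only
    split_ifs
    · exact MeasurableSet.iUnion fun i => hB i k
    · exact MeasurableSet.iInter fun i => hB i k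
  · refine eq_empty_of_forall_notMem fun z hz => ?_
    rw [mem_iInter] at hz
    have h1 := hz k₀
    rw [if_pos rfl, mem_iUnion] at h1
    obtain ⟨i, hi⟩ := h1
    have : z ∈ ⋂ k, B i k := by
      refine mem_iInter.2 fun k => ?_
      by_cases hk : k = k₀
      · rwa [hk]
      · have h2 := hz k
        rw [if_neg hk] at h2
        exact mem_iInter.1 h2 i
    rw [hB0 i] at this
    exact this

/-- If separation fails, refining one coordinate of one parametrization at a time preserves the
failure and yields limit points in all the parameter spaces. Two of their images differ, and
disjoint open neighbourhoods separate a late stage: a contradiction. -/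
theorem measurablySeparableSeq_range {Z : Type*} [TopologicalSpace Z] [T2Space Z]
    [MeasurableSpace Z] [OpensMeasurableSpace Z] {g : ℕ → (ℕ → ℕ) → Z}
    (hg : ∀ k, Continuous (g k)) (h : ⋂ k, range (g k) = ∅) :
    MeasurablySeparableSeq fun k => range (g k) := by
  by_contra hns
  -- One sequence `α` codes a sequence for every `k` through `Nat.pair`; stage `m` has fixed the
  -- entries with code below `m`.
  let N : ℕ → (ℕ → ℕ) → ℕ → Set (ℕ → ℕ) :=
    fun m α k => {β | ∀ j, Nat.pair k j < m → β j = α (Nat.pair k j)}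
  obtain ⟨α, hα⟩ := exists_branch
    (P := fun m α => ¬ MeasurablySeparableSeq fun k => g k '' N m α k)
    (by
      intro m α β hαβ hP hβ
      refine hP (hβ.mono fun k => image_mono ?_)
      intro γ hγ j hj
      rw [hγ j hj, hαβ _ hj])
    (fun _ => 0)
    (by
      refine fun hP => hns (hP.mono fun k => ?_)
      rintro _ ⟨β, rfl⟩
      exact ⟨β, fun j hj => absurd hj (Nat.not_lt_zero _), rfl⟩)
    (by
      intro m α
      contrapose!
      intro hi
      refine MeasurablySeparableSeq.of_iUnion (k₀ := m.unpair.1) hi ?_ ?_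
      · rintro _ ⟨β, hβ, rfl⟩
        refine mem_iUnion.2 ⟨β m.unpair.2, β, fun j hj => ?_, rfl⟩
        rcases Nat.lt_succ_iff_lt_or_eq.1 hj with hj | hj
        · rw [update_of_ne hj.ne]
          exact hβ j hj
        · rw [hj, update_self, ← hj, Nat.unpair_pair]
      · rintro i k hk
        refine image_mono fun β hβ j hj => ?_
        rcases Nat.lt_succ_iff_lt_or_eq.1 hj with hj | hj
        · rw [update_of_ne hj.ne]
          exact hβ j hj
        · refine absurd ?_ hk
          rw [← hj, Nat.unpair_pair])
  let β : ℕ → ℕ → ℕ := fun k j => α (Nat.pair k j)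
  have hsmall : ∀ k (U : Set Z), IsOpen U → g k (β k) ∈ U →
      ∃ m, ∀ m' ≥ m, g k '' N m' α k ⊆ U := by
    intro k U hU hmem
    have hnhds : g k ⁻¹' U ∈ nhds (β k) := (hg k).continuousAt.preimage_mem_nhds (hU.mem_nhds hmem)
    rw [nhds_pi, Filter.mem_pi] at hnhds
    obtain ⟨I, hI, t, ht, hsub⟩ := hnhds
    obtain ⟨m, hm⟩ := (hI.image fun j => Nat.pair k j).bddAbove
    refine ⟨m + 1, fun m' hm' => image_subset_iff.2 fun γ hγ => hsub fun j hj => ?_⟩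
    have : γ j = β k j := hγ j (lt_of_lt_of_le (Nat.lt_succ_of_le (hm ⟨j, hj, rfl⟩)) hm')
    rw [this]
    exact mem_of_mem_nhds (ht j)
  obtain ⟨i, j, hij⟩ : ∃ i j, g i (β i) ≠ g j (β j) := by
    by_contra! hall
    have : g 0 (β 0) ∈ ⋂ k, range (g k) := mem_iInter.2 fun k => ⟨β k, (hall 0 k).symm⟩
    rw [h] at this
    exact this
  obtain ⟨U, W, hU, hW, hiU, hjW, hUW⟩ := t2_separation hij
  obtain ⟨a, ha⟩ := hsmall i U hU hiU
  obtain ⟨b, hb⟩ := hsmall j W hW hjW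
  have hne : i ≠ j := fun e => hij (by rw [e])
  refine hα (max a b) ⟨fun k => if k = i then U else if k = j then W else univ, ?_, ?_, ?_⟩
  · intro k
    dsimp only
    split_ifs with h1 h2
    · subst h1; exact ha _ (le_max_left _ _)
    · subst h2; exact hb _ (le_max_right _ _)
    · exact subset_univ _
  · intro k
    dsimp only
    split_ifs
    exacts [hU.measurableSet, hW.measurableSet, MeasurableSet.univ]
  · refine eq_empty_of_forall_notMem fun z hz => ?_
    rw [mem_iInter] at hz
    have h1 := hz i
    have h2 := hz j
    rw [if_pos rfl] at h1
    rw [if_neg hne.symm, if_pos rfl] at h2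
    exact disjoint_left.1 hUW h1 h2

/-- The countable (Novikov) form of the Lusin separation theorem. -/
theorem measurablySeparableSeq_of_analyticSet {Z : Type*} [TopologicalSpace Z] [T2Space Z]
    [MeasurableSpace Z] [OpensMeasurableSpace Z] {A : ℕ → Set Z}
    (hA : ∀ k, AnalyticSet (A k)) (h : ⋂ k, A k = ∅) : MeasurablySeparableSeq A := by
  by_cases hemp : ∃ k, A k = ∅
  · obtain ⟨k₀, hk₀⟩ := hemp
    refine ⟨fun k => if k = k₀ then ∅ else univ, fun k => ?_, fun k => ?_, ?_⟩
    · dsimp only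
      split_ifs with hk
      · rw [hk, hk₀]
      · exact subset_univ _
    · dsimp only
      split_ifs
      exacts [MeasurableSet.empty, MeasurableSet.univ]
    · refine eq_empty_of_forall_notMem fun z hz => ?_
      have h1 := mem_iInter.1 hz k₀
      rw [if_pos rfl] at h1
      exact h1
  · push Not at hemp
    have : ∀ k, ∃ g : (ℕ → ℕ) → Z, Continuous g ∧ range g = A k := by
      intro k
      have hk := hA k
      rw [AnalyticSet] at hk
      exact hk.resolve_left (hemp k).ne_empty
    choose g hg hr using this
    have := measurablySeparableSeq_range hg (by simpa only [hr] using h)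
    simpa only [hr] using this

/-! ### Uniformization of Borel sets with finite sections -/

/-- A finite-to-one Borel map is injective on each piece of some countable Borel partition. -/
theorem exists_countable_injOn_cover {Y Z : Type*} [MeasurableSpace Y] [StandardBorelSpace Y]
    [MeasurableSpace Z] [StandardBorelSpace Z] {f : Y → Z} (hf : Measurable f)
    (hfin : ∀ z, (f ⁻¹' {z}).Finite) :
    ∃ B : (Σ m : ℕ, Fin m → Bool) → Set Y,
      (∀ i, MeasurableSet (B i)) ∧ (∀ i, InjOn f (B i)) ∧ ⋃ i, B i = univ := by
  let := upgradeStandardBorel Z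
  obtain ⟨c, hc, hcinj⟩ := MeasurableSpace.measurable_injection_nat_bool_of_countablySeparated Y
  -- Pairs witnessing that the first `m` bits of the code `c` do not yet separate the fibre.
  let R : ℕ → Set (Y × Y) := fun m => {p | f p.1 = f p.2 ∧ p.1 ≠ p.2 ∧ ∀ i < m, c p.1 i = c p.2 i}
  have hci : ∀ i, Measurable fun y => c y i := fun i => (measurable_pi_apply i).comp hc
  have hR : ∀ m, MeasurableSet (R m) := by
    intro m
    have : R m = {p | f p.1 = f p.2} ∩ ({p | p.1 = p.2}ᶜ ∩ ⋂ i, ⋂ _ : i < m,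
        {p | c p.1 i = c p.2 i}) := by
      ext p
      simp [R]
    rw [this]
    exact (measurableSet_eq_fun (hf.comp measurable_fst) (hf.comp measurable_snd)).inter
      ((measurableSet_eq_fun measurable_fst measurable_snd).compl.inter <|
        MeasurableSet.iInter fun i => MeasurableSet.iInter fun _ =>
          measurableSet_eq_fun ((hci i).comp measurable_fst) ((hci i).comp measurable_snd))
  have hsep : MeasurablySeparableSeq fun m => (fun p : Y × Y => f p.1) '' R m := by
    refine measurablySeparableSeq_of_analyticSet
      (fun m => (hR m).analyticSet_image (hf.comp measurable_fst)) ?_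
    refine eq_empty_of_forall_notMem fun z hz => ?_
    rw [mem_iInter] at hz
    have hex : ∀ p : Y × Y, ∃ i, p.1 ≠ p.2 → c p.1 i ≠ c p.2 i := by
      intro p
      by_cases hp : p.1 = p.2
      · exact ⟨0, fun h => absurd hp h⟩
      · obtain ⟨i, hi⟩ := Function.ne_iff.1 (hcinj.ne hp)
        exact ⟨i, fun _ => hi⟩
    choose d hd using hex
    -- A finite fibre has finitely many pairs, so their separating bits are bounded.
    obtain ⟨m, hm⟩ := (((hfin z).prod (hfin z)).image d).bddAbove
    obtain ⟨p, ⟨hp₁, hp₂, hp₃⟩, hpz⟩ := hz (m + 1)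
    exact hd p hp₂ (hp₃ _ (Nat.lt_succ_of_le (hm ⟨p, ⟨hpz, hp₁.symm.trans hpz⟩, rfl⟩)))
  obtain ⟨D, hRD, hD, hD0⟩ := hsep
  -- Outside `D m` the first `m` bits identify a point within its fibre, so prescribing them makes
  -- `f` injective.
  refine ⟨fun i => {y | f y ∉ D i.1 ∧ ∀ j : Fin i.1, c y j = i.2 j}, ?_, ?_, ?_⟩
  · rintro ⟨m, w⟩
    have : {y | f y ∉ D m ∧ ∀ j : Fin m, c y j = w j} =
        (f ⁻¹' D m)ᶜ ∩ ⋂ j : Fin m, {y | c y j = w j} := by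
      ext y
      simp
    dsimp only
    rw [this]
    exact (hf (hD m)).compl.inter <|
      MeasurableSet.iInter fun j => measurableSet_eq_fun (hci j) measurable_const
  · rintro ⟨m, w⟩ y ⟨hy, hyw⟩ y' ⟨-, hyw'⟩ hyy'
    by_contra hne
    exact hy (hRD m ⟨(y, y'), ⟨hyy', hne, fun i hi => (hyw ⟨i, hi⟩).trans (hyw' ⟨i, hi⟩).symm⟩, rfl⟩)
  · refine eq_univ_of_forall fun y => ?_
    have : f y ∉ ⋂ k, D k := by rw [hD0]; exact notMem_empty _
    rw [mem_iInter, not_forall] at this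
    obtain ⟨m, hm⟩ := this
    exact mem_iUnion.2 ⟨⟨m, fun j => c y j⟩, hm, fun _ => rfl⟩

/-- A Borel relation with finite sections is enumerated by countably many Borel functions. -/
theorem exists_measurable_enumeration {V : Type*} [MeasurableSpace V] [StandardBorelSpace V]
    {E : Set (V × V)} (hE : MeasurableSet E) (hfin : ∀ x, {y | (x, y) ∈ E}.Finite) :
    ∃ g : (Σ m : ℕ, Fin m → Bool) → V → V, (∀ i, Measurable (g i)) ∧
      (∀ i x, g i x = x ∨ (x, g i x) ∈ E) ∧ ∀ x y, (x, y) ∈ E → ∃ i, g i x = y := by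
  classical
  have : StandardBorelSpace E := hE.standardBorel
  have hfst : Measurable fun p : E => p.1.1 := measurable_fst.comp measurable_subtype_coe
  have hsnd : Measurable fun p : E => p.1.2 := measurable_snd.comp measurable_subtype_coe
  obtain ⟨B, hB, hinj, hcov⟩ := exists_countable_injOn_cover hfst (by
    intro x
    refine Finite.of_finite_image (f := fun p : E => p.1.2) ((hfin x).subset ?_) ?_
    · rintro _ ⟨⟨⟨a, b⟩, hp⟩, rfl, rfl⟩
      exact hp
    · rintro ⟨⟨a, b⟩, hp⟩ rfl ⟨⟨a', b'⟩, hp'⟩ h1 h2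
      simp only [mem_preimage, mem_singleton_iff] at h1 h2
      subst h1 h2
      rfl)
  -- Lusin–Souslin: injective Borel images of Borel sets are Borel.
  have himg : ∀ i {S : Set E}, MeasurableSet S → S ⊆ B i →
      MeasurableSet ((fun p : E => p.1.1) '' S) := fun i S hS hSB =>
    hS.image_of_measurable_injOn hfst ((hinj i).mono hSB)
  -- The default `x` makes each function either stand still or move along `E`.
  let g : (Σ m : ℕ, Fin m → Bool) → V → V := fun i x =>
    if h : ∃ p : E, p ∈ B i ∧ p.1.1 = x then h.choose.1.2 else x
  have hg : ∀ i (p : E), p ∈ B i → g i p.1.1 = p.1.2 := by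
    intro i p hp
    have h : ∃ q : E, q ∈ B i ∧ q.1.1 = p.1.1 := ⟨p, hp, rfl⟩
    have : h.choose = p := hinj i h.choose_spec.1 hp h.choose_spec.2
    simp only [g, dif_pos h, this]
  have hg' : ∀ i x, x ∉ (fun p : E => p.1.1) '' B i → g i x = x := fun i x hx => dif_neg hx
  refine ⟨g, fun i S hS => ?_, fun i x => ?_, fun x y hxy => ?_⟩
  · have : g i ⁻¹' S = (fun p : E => p.1.1) '' (B i ∩ (fun p : E => p.1.2) ⁻¹' S) ∪
        (S \ (fun p : E => p.1.1) '' B i) := by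
      ext x
      by_cases hx : x ∈ (fun p : E => p.1.1) '' B i
      · obtain ⟨p, hp, rfl⟩ := hx
        simp only [mem_preimage, hg i p hp]
        constructor
        · exact fun h => Or.inl ⟨p, ⟨hp, h⟩, rfl⟩
        · rintro (⟨q, ⟨hq, hqS⟩, hqp⟩ | ⟨-, h⟩)
          · rwa [← hinj i hq hp hqp]
          · exact absurd ⟨p, hp, rfl⟩ h
      · rw [mem_preimage, hg' i x hx]
        constructor
        · exact fun h => Or.inr ⟨h, hx⟩
        · rintro (⟨q, ⟨hq, -⟩, hqp⟩ | ⟨h, -⟩)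
          · exact absurd ⟨q, hq, hqp⟩ hx
          · exact h
    rw [this]
    exact (himg i ((hB i).inter (hsnd hS)) inter_subset_left).union
      (hS.diff (himg i (hB i) Subset.rfl))
  · by_cases hx : x ∈ (fun p : E => p.1.1) '' B i
    · obtain ⟨p, hp, rfl⟩ := hx
      right
      change (p.1.1, g i p.1.1) ∈ E
      rw [hg i p hp]
      exact p.2
    · exact Or.inl (hg' i x hx)
  · have : (⟨(x, y), hxy⟩ : E) ∈ ⋃ i, B i := by rw [hcov]; exact mem_univ _
    obtain ⟨i, hi⟩ := mem_iUnion.1 this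
    exact ⟨i, hg i _ hi⟩

end BorelLCL
-- Borel enumeration of components and Borel dependence of ball types
namespace BorelLCL
open Set Function MeasureTheory

universe u

/-- Measurable choice of an element of a countable type. -/
theorem exists_measurable_selection {α ι : Type*} [MeasurableSpace α] [MeasurableSpace ι]
    [Countable ι] [Nonempty ι] {p : ι → α → Prop} (hp : ∀ i, Measurable (p i)) :
    ∃ f : α → ι, Measurable f ∧ ∀ x, (∃ i, p i x) → p (f x) x := by
  classical
  obtain ⟨s, hs⟩ := exists_surjective_nat ι
  -- The second alternative makes the search terminate at points where no index is valid.
  let q : α → ℕ → Prop := fun x k => p (s k) x ∨ ¬ ∃ i, p i x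
  have hq : ∀ x, ∃ k, q x k := by
    intro x
    by_cases h : ∃ i, p i x
    · obtain ⟨i, hi⟩ := h
      obtain ⟨k, rfl⟩ := hs i
      exact ⟨k, Or.inl hi⟩
    · exact ⟨0, Or.inr h⟩
  have hqm : ∀ k, MeasurableSet {x | q x k} := fun k =>
    ((hp (s k)).or (Measurable.exists hp).not).setOf
  refine ⟨fun x => s (Nat.find (hq x)), (measurable_from_top (f := s)).comp (measurable_find hq hqm),
    fun x hx => (Nat.find_spec (hq x)).resolve_right (not_not_intro hx)⟩

/-- Apply the functions with indices in a word one after another. -/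
def applyWord {ι V : Type*} (g : ι → V → V) (w : List ι) (x : V) : V :=
  w.foldl (fun y i => g i y) x

theorem measurable_applyWord {ι V : Type*} [MeasurableSpace V] {g : ι → V → V}
    (hg : ∀ i, Measurable (g i)) (w : List ι) : Measurable (applyWord g w) := by
  induction w with
  | nil => exact measurable_id
  | cons i w ih => exact ih.comp (hg i)

section Words

variable {ι : Type*} {V : Type u} {G : SimpleGraph V} {g : ι → V → V}

theorem exists_walk_applyWord (hg : ∀ i x, g i x = x ∨ G.Adj x (g i x)) (w : List ι) (x : V) :
    ∃ p : G.Walk x (applyWord g w x), p.length ≤ w.length := by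
  induction w generalizing x with
  | nil => exact ⟨SimpleGraph.Walk.nil, le_rfl⟩
  | cons i w ih =>
    have ih := ih (g i x)
    change ∃ p : G.Walk x (applyWord g w (g i x)), p.length ≤ w.length + 1
    rcases hg i x with h | h
    · rw [h] at ih ⊢
      obtain ⟨p, hp⟩ := ih
      exact ⟨p, hp.trans (Nat.le_succ _)⟩
    · obtain ⟨p, hp⟩ := ih
      exact ⟨SimpleGraph.Walk.cons h p, Nat.succ_le_succ hp⟩

theorem exists_applyWord_of_walk (hg : ∀ x y, G.Adj x y → ∃ i, g i x = y) {x y : V}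
    (p : G.Walk x y) : ∃ w : List ι, w.length = p.length ∧ applyWord g w x = y := by
  induction p with
  | nil => exact ⟨[], rfl, rfl⟩
  | cons h p ih =>
    obtain ⟨w, hw, hwy⟩ := ih
    obtain ⟨i, rfl⟩ := hg _ _ h
    exact ⟨i :: w, by simp [hw], hwy⟩

theorem reachable_iff_exists_applyWord (hg : ∀ i x, g i x = x ∨ G.Adj x (g i x))
    (hg' : ∀ x y, G.Adj x y → ∃ i, g i x = y) {x y : V} :
    G.Reachable x y ↔ ∃ w, applyWord g w x = y := by
  constructor
  · rintro ⟨p⟩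
    obtain ⟨w, -, hw⟩ := exists_applyWord_of_walk hg' p
    exact ⟨w, hw⟩
  · rintro ⟨w, rfl⟩
    obtain ⟨p, -⟩ := exists_walk_applyWord hg w x
    exact ⟨p⟩

/-- Letters that stand still only shorten the walk, while each step of a walk is realized by some
letter. -/
theorem edist_le_iff_exists_applyWord (hg : ∀ i x, g i x = x ∨ G.Adj x (g i x))
    (hg' : ∀ x y, G.Adj x y → ∃ i, g i x = y) {x y : V} {r : ℕ} :
    G.edist x y ≤ r ↔ ∃ w : List ι, w.length ≤ r ∧ applyWord g w x = y := by
  constructor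
  · intro h
    obtain ⟨p, hp⟩ := G.exists_walk_of_edist_ne_top (h.trans_lt (ENat.natCast_lt_top r)).ne
    obtain ⟨w, hw, hwy⟩ := exists_applyWord_of_walk hg' p
    refine ⟨w, ?_, hwy⟩
    rw [hw]
    rw [← hp] at h
    exact_mod_cast h
  · rintro ⟨w, hw, rfl⟩
    obtain ⟨p, hp⟩ := exists_walk_applyWord hg w x
    exact p.edist_le.trans (by exact_mod_cast hp.trans hw)

end Words

theorem finite_closedBall {V : Type u} {G : SimpleGraph V} (hfin : IsLocallyFinite G) (r : ℕ)
    (x : V) : (closedBall G x r).Finite := by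
  induction r generalizing x with
  | zero =>
    refine (finite_singleton x).subset fun y hy => ?_
    have : G.edist x y ≤ (0 : ℕ) := hy
    rw [Nat.cast_zero] at this
    exact (SimpleGraph.edist_eq_zero_iff.1 (le_antisymm this bot_le)).symm
  | succ r ih =>
    refine ((finite_singleton x).union ((hfin x).biUnion fun z _ => ih z)).subset fun y hy => ?_
    have hy : G.edist x y ≤ (r + 1 : ℕ) := hy
    obtain ⟨p, hp⟩ := G.exists_walk_of_edist_ne_top (hy.trans_lt (ENat.natCast_lt_top _)).ne
    rw [← hp] at hy
    cases p with
    | nil => exact Or.inl rfl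
    | cons h q =>
      refine Or.inr (mem_biUnion (x := _) h ?_)
      refine q.edist_le.trans ?_
      rw [SimpleGraph.Walk.length_cons] at hy
      exact_mod_cast Nat.le_of_succ_le_succ (by exact_mod_cast hy)

theorem reachable_of_mem_closedBall {V : Type u} {G : SimpleGraph V} {x y : V} {r : ℕ}
    (h : y ∈ closedBall G x r) : G.Reachable x y :=
  G.reachable_of_edist_ne_top (lt_of_le_of_lt h (ENat.natCast_lt_top r)).ne

/-- Measurable functions enumerate the components of a locally finite Borel graph, and the
distance is Borel. -/
theorem exists_component_enumeration {V : Type u} [MeasurableSpace V] [StandardBorelSpace V]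
    {G : SimpleGraph V} (hG : IsBorelGraph G) (hfin : IsLocallyFinite G) :
    ∃ e : ℕ → V → V, (∀ k, Measurable (e k)) ∧ (∀ x y, G.Reachable x y ↔ ∃ k, e k x = y) ∧
      ∀ (r : ℕ) (f h : V → V), Measurable f → Measurable h →
        Measurable fun x => G.edist (f x) (h x) ≤ r := by
  obtain ⟨g, hgm, hg, hg'⟩ := exists_measurable_enumeration hG (fun x => hfin x)
  have hg : ∀ i x, g i x = x ∨ G.Adj x (g i x) := hg
  have hg' : ∀ x y, G.Adj x y → ∃ i, g i x = y := hg'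
  obtain ⟨s, hs⟩ := exists_surjective_nat (List (Σ m : ℕ, Fin m → Bool))
  refine ⟨fun k => applyWord g (s k), fun k => measurable_applyWord hgm _, fun x y => ?_,
    fun r f h hf hh => ?_⟩
  · rw [reachable_iff_exists_applyWord hg hg']
    exact (hs.exists (p := fun w => applyWord g w x = y))
  · simp only [edist_le_iff_exists_applyWord hg hg']
    exact Measurable.exists fun w => measurable_const.and <| measurableSet_setOfPred.1 <|
      measurableSet_eq_fun ((measurable_applyWord hgm w).comp hf) hh

theorem ballType_congr {V : Type u} {L : Type} {G : SimpleGraph V} {lab lab' : V → L} {r : ℕ}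
    {x : V} (h : ∀ y ∈ closedBall G x r, lab y = lab' y) :
    ballType G lab r x = ballType G lab' r x :=
  Quotient.sound ⟨SimpleGraph.Iso.refl, fun v : closedBall G x r => (h v v.2).symm, rfl⟩

/-- Two balls are isomorphic if finite initial segments of two enumerations cover them and agree on
membership in the ball, equality, adjacency, the root and the labels. -/
theorem ballType_eq_of_enumerations {V : Type u} {L : Type} {G : SimpleGraph V} {lab : V → L}
    {r : ℕ} {x x' : V} {ι : Type*} {c c' : ι → V}
    (hx : ∀ y ∈ closedBall G x r, ∃ i, c i = y) (hx' : ∀ y ∈ closedBall G x' r, ∃ i, c' i = y)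
    (hball : ∀ i, c i ∈ closedBall G x r ↔ c' i ∈ closedBall G x' r)
    (heq : ∀ i j, c i = c j ↔ c' i = c' j) (hadj : ∀ i j, G.Adj (c i) (c j) ↔ G.Adj (c' i) (c' j))
    (hroot : ∀ i, c i = x ↔ c' i = x') (hlab : ∀ i, lab (c i) = lab (c' i)) :
    ballType G lab r x = ballType G lab r x' := by
  choose idx hidx using fun y : closedBall G x r => hx y y.2
  have hmem : ∀ y, c' (idx y) ∈ closedBall G x' r := fun y => by
    rw [← hball, hidx]; exact y.2
  let φ : closedBall G x r → closedBall G x' r := fun y => ⟨c' (idx y), hmem y⟩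
  have hinj : Injective φ := by
    intro y z h
    have h := (heq _ _).2 (congrArg Subtype.val h)
    rw [hidx, hidx] at h
    exact Subtype.ext h
  have hsurj : Surjective φ := by
    rintro ⟨y', hy'⟩
    obtain ⟨i, rfl⟩ := hx' y' hy'
    refine ⟨⟨c i, (hball i).2 hy'⟩, Subtype.ext ?_⟩
    exact (heq _ _).1 (hidx ⟨c i, (hball i).2 hy'⟩)
  have hφ : ∀ y z : closedBall G x r, G.Adj (φ y) (φ z) ↔ G.Adj y z := by
    intro y z
    change G.Adj (c' (idx y)) (c' (idx z)) ↔ _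
    rw [← hadj, hidx, hidx]
  refine Quotient.sound ⟨⟨Equiv.ofBijective φ ⟨hinj, hsurj⟩, fun {y z} => hφ y z⟩,
    fun y : closedBall G x r => ?_, ?_⟩
  · change lab (c' (idx y)) = lab y
    rw [← hlab, hidx]
  · refine Subtype.ext ((hroot _).1 (hidx _))

/-- Every property of the isomorphism types of balls in a Borel labelled graph is Borel. -/
theorem measurable_ballType {V : Type u} [MeasurableSpace V] [StandardBorelSpace V]
    {G : SimpleGraph V} (hG : IsBorelGraph G) (hfin : IsLocallyFinite G) {L : Type}
    [Countable L] [MeasurableSpace L] [MeasurableSingletonClass L] {lab : V → L}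
    (hlab : Measurable lab) (r : ℕ) (P : IsoType.{u} L → Prop) :
    Measurable fun x => P (ballType G lab r x) := by
  obtain ⟨e, he, hreach, hdist⟩ := exists_component_enumeration hG hfin
  -- The values of `D N` lie in a countable type with measurable singletons, so every condition on
  -- `D N x` is Borel, however wild `P` is.
  let D : ∀ N, V → Fin N → Fin N → Prop × Prop × Prop × Prop × L := fun N x i j =>
    (e i x ∈ closedBall G x r, e i x = e j x, G.Adj (e i x) (e j x), e i x = x, lab (e i x))
  have hD : ∀ N, Measurable (D N) := fun N =>
    measurable_pi_lambda _ fun i => measurable_pi_lambda _ fun j =>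
      (hdist r _ _ measurable_id (he i)).prodMk <|
      (measurableSet_setOfPred.1 (measurableSet_eq_fun (he i) (he j))).prodMk <|
      (measurableSet_setOfPred.1 (((he i).prodMk (he j)) hG)).prodMk <|
      (measurableSet_setOfPred.1 (measurableSet_eq_fun (he i) measurable_id)).prodMk (hlab.comp (he i))
  let cov : ℕ → V → Prop := fun N x =>
    ∀ k, e k x ∈ closedBall G x r → ∃ i : Fin N, e i x = e k x
  have hcov : ∀ N, Measurable (cov N) := fun N =>
    Measurable.forall fun k => (hdist r _ _ measurable_id (he k)).imp <|
      Measurable.exists fun i => measurableSet_setOfPred.1 (measurableSet_eq_fun (he i) (he k))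
  have hcov_mem : ∀ {N x}, cov N x → ∀ y ∈ closedBall G x r, ∃ i : Fin N, e i x = y := by
    intro N x h y hy
    obtain ⟨k, rfl⟩ := (hreach x y).1 (reachable_of_mem_closedBall hy)
    exact h k hy
  have hex : ∀ x, ∃ N, cov N x := by
    intro x
    choose! k hk using fun y (hy : y ∈ closedBall G x r) =>
      (hreach x y).1 (reachable_of_mem_closedBall hy)
    obtain ⟨m, hm⟩ := ((finite_closedBall hfin r x).image k).bddAbove
    exact ⟨m + 1, fun j hj =>
      ⟨⟨k (e j x), Nat.lt_succ_of_le (hm ⟨_, hj, rfl⟩)⟩, hk _ hj⟩⟩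
  -- Once the first `N` terms cover the ball, `D N x` determines its isomorphism type.
  have key : ∀ x, P (ballType G lab r x) ↔
      ∃ N, cov N x ∧ D N x ∈ D N '' {x' | cov N x' ∧ P (ballType G lab r x')} := by
    intro x
    constructor
    · intro h
      obtain ⟨N, hN⟩ := hex x
      exact ⟨N, hN, x, ⟨hN, h⟩, rfl⟩
    · rintro ⟨N, hN, x', ⟨hN', hP⟩, hDD⟩
      have hd := fun i j => congrFun (congrFun hDD i) j
      simp only [D, Prod.mk.injEq, eq_iff_iff] at hd
      rwa [← ballType_eq_of_enumerations (hcov_mem hN') (hcov_mem hN) (fun i => (hd i i).1)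
        (fun i j => (hd i j).2.1) (fun i j => (hd i j).2.2.1) (fun i => (hd i i).2.2.2.1)
        (fun i => (hd i i).2.2.2.2)]
  rw [funext fun x => propext (key x)]
  exact Measurable.exists fun N => (hcov N).and <|
    measurableSet_setOfPred.1 (hD N (Set.to_countable _).measurableSet)

end BorelLCL
-- Borel compactness and the solution along the transversal
namespace BorelLCL
open Set Function MeasureTheory

theorem measurable_apply_of_countable {ι α β : Type*} [Countable ι] [MeasurableSpace ι]
    [MeasurableSingletonClass ι] [MeasurableSpace α] [MeasurableSpace β] {f : ι → α → β}
    (hf : ∀ i, Measurable (f i)) {i : α → ι} (hi : Measurable i) {g : α → α} (hg : Measurable g) :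
    Measurable fun x => f (i x) (g x) :=
  (measurable_from_prod_countable_right (f := fun p : ι × α => f p.1 p.2) hf).comp (hi.prodMk hg)

/-- Measurable choice of solutions of countably many Borel constraints on sequences in a finite
set, each of which depends on finitely many entries. -/
theorem exists_measurable_solution {α A : Type*} [MeasurableSpace α] [Finite A] [Nonempty A]
    [MeasurableSpace A] [MeasurableSingletonClass A] {R : ℕ → (ℕ → A) → α → Prop}
    (hR : ∀ k b, Measurable (R k b))
    (hloc : ∀ k x, ∃ m, ∀ b b', (∀ i < m, b i = b' i) → R k b x → R k b' x) :
    ∃ B : ℕ → α → A, (∀ i, Measurable (B i)) ∧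
      ∀ x, (∃ b, ∀ k, R k b x) → ∀ k, R k (fun i => B i x) x := by
  obtain ⟨d⟩ := ‹Nonempty A›
  have : Nonempty A := ⟨d⟩
  have := Fintype.ofFinite A
  let ext : List A → ℕ → A := fun w i => w.getD i d
  -- Finite satisfiability replaces the existence of an infinite solution extending `w`, which would
  -- quantify over uncountably many sequences.
  let Q : List A → α → Prop := fun w x => ∀ M, ∃ t, ∀ k < M, R k (ext (w ++ t)) x
  have hQm : ∀ w, Measurable (Q w) := fun w =>
    Measurable.forall fun M => Measurable.exists fun t => Measurable.forall fun k =>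
      measurable_const.imp (hR _ _)
  have hQnil : ∀ x, (∃ b, ∀ k, R k b x) → Q [] x := by
    rintro x ⟨b, hb⟩ M
    choose m hm using fun k => hloc k x
    let N := (Finset.range M).sup m
    refine ⟨(List.range N).map b, fun k hk => hm k b _ (fun i hi => ?_) (hb k)⟩
    have hiN : i < N := hi.trans_le (Finset.le_sup (f := m) (Finset.mem_range.2 hk))
    simp [ext, List.getD_eq_getElem?_getD, hiN]
  have hQstep : ∀ w x, Q w x → ∃ v, Q (w ++ [v]) x := by
    intro w x hw
    by_contra! hcon
    have : ∀ v, ∃ M, ∀ t, ∃ k < M, ¬ R k (ext (w ++ [v] ++ t)) x := by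
      intro v
      have := hcon v
      simp only [Q] at this
      push Not at this
      exact this
    choose M hM using this
    -- Finiteness of `A` bounds all the failure levels at once; the first letter of `t` then
    -- contradicts its own level.
    obtain ⟨t, ht⟩ := hw (Finset.univ.sup M)
    have hlt : ∀ {v k}, k < M v → k < Finset.univ.sup M := fun {v k} hk =>
      hk.trans_le (Finset.le_sup (f := M) (Finset.mem_univ v))
    cases t with
    | nil =>
      -- An empty `t` is harmless: appending the padding value `d` leaves the padded sequence
      -- unchanged.
      obtain ⟨k, hk, hn⟩ := hM d []
      refine hn ?_
      have : ext (w ++ [d] ++ []) = ext (w ++ []) := by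
        funext i
        simp only [ext, List.append_nil]
        rcases lt_or_ge i w.length with hi | hi
        · rw [List.getD_append _ _ _ _ hi]
        · rw [List.getD_append_right _ _ _ _ hi, List.getD_eq_default _ _ hi]
          cases i - w.length <;> simp
      rw [this]
      exact ht k (hlt hk)
    | cons v t =>
      obtain ⟨k, hk, hn⟩ := hM v t
      refine hn ?_
      rw [List.append_assoc]
      exact ht k (hlt hk)
  choose sel hselm hsel using fun w : List A =>
    exists_measurable_selection (p := fun v x => Q (w ++ [v]) x) (fun v => hQm _)
  let s : ℕ → α → List A := fun m x =>
    Nat.rec [] (fun _ w => w ++ [sel w x]) m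
  have hs : ∀ m x, s (m + 1) x = s m x ++ [sel (s m x) x] := fun _ _ => rfl
  let : MeasurableSpace (List A) := ⊤
  have hsm : ∀ m, Measurable (s m) := by
    intro m
    induction m with
    | zero => exact measurable_const
    | succ m ih =>
      exact measurable_apply_of_countable (f := fun w x => w ++ [sel w x])
        (fun w => (measurable_of_countable fun v : A => w ++ [v]).comp (hselm w)) ih measurable_id
  have hlen : ∀ m x, (s m x).length = m := by
    intro m x
    induction m with
    | zero => rfl
    | succ m ih => rw [hs, List.length_append, ih]; rfl
  have hstable : ∀ x i c, ext (s (i + 1 + c) x) i = ext (s (i + 1) x) i := by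
    intro x i c
    induction c with
    | zero => rfl
    | succ c ih =>
      rw [← ih, ← add_assoc, hs]
      exact List.getD_append _ _ _ _ (by rw [hlen]; omega)
  refine ⟨fun i x => ext (s (i + 1) x) i, fun i => ?_, fun x hx k => ?_⟩
  · have hext : Measurable fun w => ext w i := fun _ _ => MeasurableSpace.measurableSet_top
    exact hext.comp (hsm (i + 1))
  · have hQs : ∀ m, Q (s m x) x := by
      intro m
      induction m with
      | zero => exact hQnil x hx
      | succ m ih => exact hsel _ x (hQstep _ x ih)
    obtain ⟨m, hm⟩ := hloc k x
    -- Constraint `k` sees only the first `m` entries at `x`, where this extension agrees with the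
    -- limit.
    obtain ⟨t, ht⟩ := hQs m (k + 1)
    refine hm _ _ (fun i hi => ?_) (ht k (Nat.lt_succ_self k))
    obtain ⟨c, rfl⟩ : ∃ c, m = i + 1 + c := ⟨m - (i + 1), by omega⟩
    refine Eq.trans ?_ (hstable x i c)
    exact List.getD_append _ _ _ _ (by rw [hlen]; exact hi)

end BorelLCL

theorem theorem5p16 {V : Type*} [MeasurableSpace V] [StandardBorelSpace V]
    (G : SimpleGraph V) (hG : BorelLCL.IsBorelGraph G) (hfin : BorelLCL.IsLocallyFinite G)
    (X : Set V) (hXmeas : MeasurableSet X) (hX : BorelLCL.IsTransversal G X)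
    (ℓ : V → ℕ) (hℓ : Measurable ℓ) (n : ℕ) (C : BorelLCL.LCL)
    (hsol : ∃ a : V → Fin n, C.Solves G ℓ (fun x => (a x : ℕ))) :
    ∃ a : V → Fin n, Measurable a ∧ C.Solves G ℓ (fun x => (a x : ℕ)) := by
  open BorelLCL in
  obtain ⟨a, ha⟩ := hsol
  rcases isEmpty_or_nonempty V with hV | ⟨⟨x₀⟩⟩
  · exact ⟨a, measurable_of_empty a, ha⟩
  have : Nonempty (Fin n) := ⟨a x₀⟩
  obtain ⟨e, he, hreach, -⟩ := exists_component_enumeration hG hfin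
  -- the point of the transversal in the component of a vertex
  obtain ⟨κ, hκm, hκ⟩ := exists_measurable_selection (p := fun k x => e k x ∈ X)
    (fun k => measurableSet_setOfPred.1 (he k hXmeas))
  let ρ : V → V := fun x => e (κ x) x
  have hρm : Measurable ρ := measurable_apply_of_countable he hκm measurable_id
  have hρX : ∀ x, ρ x ∈ X := by
    intro x
    obtain ⟨z, ⟨hzX, hz⟩, -⟩ := hX (G.connectedComponentMk x)
    obtain ⟨k, rfl⟩ := (hreach x z).1 (SimpleGraph.ConnectedComponent.exact hz).symm
    exact hκ x ⟨k, hzX⟩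
  have hρr : ∀ x, G.Reachable x (ρ x) := fun x => (hreach _ _).2 ⟨_, rfl⟩
  have hρ : ∀ x y, G.Reachable x y → ρ x = ρ y := fun x y h =>
    (hX (G.connectedComponentMk x)).unique
      ⟨hρX x, SimpleGraph.ConnectedComponent.sound (hρr x).symm⟩
      ⟨hρX y, SimpleGraph.ConnectedComponent.sound (h.trans (hρr y)).symm⟩
  -- the position of a vertex in the enumeration of its component
  obtain ⟨idx, hidxm, hidx⟩ := exists_measurable_selection (p := fun k y => e k (ρ y) = y)
    (fun k => measurableSet_setOfPred.1 (measurableSet_eq_fun ((he k).comp hρm) measurable_id))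
  have hidx : ∀ y, e (idx y) (ρ y) = y := fun y =>
    hidx y ((hreach _ _).1 (hρr y).symm)
  -- One fixed `b` labels all components simultaneously through the positions `idx`. This labelling
  -- of `V` is Borel, so `measurable_ballType` applies.
  let val : (ℕ → Fin n) → V → Prop := fun b z =>
    C.value G (fun y => (ℓ y, (b (idx y) : ℕ))) z = true
  have hval : ∀ b, Measurable (val b) := fun b =>
    measurable_ballType hG hfin
      (hℓ.prodMk ((measurable_of_countable fun i => (b i : ℕ)).comp hidxm)) C.radius
      (fun T => C.rule T = true)
  have hcongr : ∀ {lab lab' : V → ℕ × ℕ} {z},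
      (∀ y ∈ closedBall G z C.radius, lab y = lab' y) → C.value G lab z = C.value G lab' z :=
    fun h => congrArg C.rule (ballType_congr h)
  obtain ⟨B, hBm, hB⟩ := exists_measurable_solution (R := fun k b x => val b (e k x))
    (fun k b => (hval b).comp (he k)) (by
      intro k x
      obtain ⟨m, hm⟩ := ((finite_closedBall hfin C.radius (e k x)).image idx).bddAbove
      refine ⟨m + 1, fun b b' hbb' h => ?_⟩
      refine (hcongr fun y hy => ?_).symm.trans h
      rw [hbb' _ (Nat.lt_succ_of_le (hm ⟨y, hy, rfl⟩))])
  refine ⟨fun y => B (idx y) (ρ y), measurable_apply_of_countable hBm hidxm hρm, fun z => ?_⟩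
  have hρz : ∀ y, G.Reachable z y → ρ y = ρ z := fun y h => (hρ z y h).symm
  -- The given solution, read along the enumeration from `ρ z`, satisfies all constraints there.
  -- Balls around the enumerated vertices stay in the component of `z`, so only positions of its
  -- vertices are consulted.
  have hsolz := hB (ρ z) ⟨fun i => a (e i (ρ z)), fun k => by
    refine (hcongr fun y hy => ?_).trans (ha (e k (ρ z)))
    have hzy : G.Reachable z y :=
      (hρr z).trans (((hreach _ _).2 ⟨k, rfl⟩).trans (reachable_of_mem_closedBall hy))
    dsimp only
    rw [← hρz y hzy, hidx]⟩ (idx z)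
  rw [hidx] at hsolz
  refine (hcongr fun y hy => ?_).trans hsolz
  dsimp only
  rw [hρz y (reachable_of_mem_closedBall hy)]
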